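/- For $n\ge 0$ let $\mathrm{Av}_n(321)$ be the set of permutations $\sigma=b_1\cdots b_n$ of $\{1,\dots,n\}$ that avoid the pattern $321$, i.e. for which there are no $i<j<k$ with $b_i>b_j>b_k$. Let $\operatorname{inv}\sigma=\#\{(i,j) : i<j,\ b_i>b_j\}$ be the number of inversions of $\sigma$, let $\operatorname{lrm}\sigma=\#\{i : b_i>b_j \text{ for all } j<i\}$ be its number of left-right maxima, and let $$I_n(q,t)=\sum_{\sigma\in\mathrm{Av}_n(321)} q^{\operatorname{inv}\sigma}\,t^{\operatorname{lrm}\sigma}.$$ For $n\ge k\ge 1$ put $$s_{n,k}=\binom{\lfloor (n-1)/2\rfloor}{\lfloor (k-1)/2\rfloor}\binom{\lceil (n-1)/2\rceil}{\lceil (k-1)/2\rceil}.$$ Then for all $n\ge 1$ the following identities of polynomials in $t$ hold: $$I_n(-1,t)=\sum_{\sigma\in\mathrm{Av}_n(321)}(-1)^{\operatorname{inv}\sigma}\,t^{\operatorname{lrm}\sigma}=\sum_{k=1}^{n}(-1)^{n-k}\,s_{n,k}\,t^k,$$ $$I_{2n}(-1,t)=(t-1)\,I_{2n-1}(-1,t),$$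 $$(n+1)\,I_{2n+1}(-1,t)=2\bigl((1+t^2)n-t\bigr)I_{2n-1}(-1,t)-(1-t^2)^2\,(n-1)\,I_{2n-3}(-1,t),$$ where for $n=1$ the last term of the third identity is $0$ because of the factor $n-1$. -/

import Mathlib

namespace PermPattern

/-- `σ` contains `π` as a pattern: some subsequence of `σ` (at positions `f 0 < f 1 < ⋯`) is order
isomorphic to `π`. Permutations of `{1,…,n}` are modelled as permutations of `Fin n`. -/
def Contains {n k : ℕ} (σ : Equiv.Perm (Fin n)) (π : Equiv.Perm (Fin k)) : Prop :=
  ∃ f : Fin k → Fin n, (∀ i j, i < j → f i < f j) ∧ ∀ i j, σ (f i) < σ (f j) ↔ π i < π j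

instance {n k : ℕ} (σ : Equiv.Perm (Fin n)) (π : Equiv.Perm (Fin k)) :
    Decidable (Contains σ π) := by
  unfold Contains
  infer_instance

/-- The permutations in `𝔖ₙ` that avoid the pattern `π`. -/
def Av (n : ℕ) {k : ℕ} (π : Equiv.Perm (Fin k)) : Finset (Equiv.Perm (Fin n)) :=
  Finset.univ.filter fun σ => ¬ Contains σ π

/-- The pattern `321`, that is, the order-reversing permutation of three letters. -/
def p321 : Equiv.Perm (Fin 3) := Fin.revPerm

/-- The inversion number. -/
def inv {n : ℕ} (σ : Equiv.Perm (Fin n)) : ℕ :=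
  (Finset.univ.filter fun p : Fin n × Fin n => p.1 < p.2 ∧ σ p.1 > σ p.2).card

/-- The number of left-right maxima. -/
def lrm {n : ℕ} (σ : Equiv.Perm (Fin n)) : ℕ :=
  (Finset.univ.filter fun i : Fin n => ∀ j, j < i → σ i > σ j).card

open Polynomial in
/-- The inversion number polynomial `Iₙ(q,t)`, as a polynomial in the outer variable `t` whose
coefficients are integer polynomials in the inner variable `q`. -/
noncomputable def invPoly (n : ℕ) : ℤ[X][X] :=
  ∑ σ ∈ Av n p321, C (X ^ inv σ) * X ^ lrm σ

open Polynomial in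
/-- The polynomial `Iₙ(-1,t)` in `t`, obtained from `Iₙ(q,t)` by the substitution `q = -1`. -/
noncomputable def signedPoly (n : ℕ) : ℤ[X] :=
  (invPoly n).map (evalRingHom (-1))

/-- The number `s_{n,k}`, meant for `n ≥ k ≥ 1`. -/
def s (n k : ℕ) : ℕ :=
  Nat.choose ⌊((n : ℚ) - 1) / 2⌋₊ ⌊((k : ℚ) - 1) / 2⌋₊ *
    Nat.choose ⌈((n : ℚ) - 1) / 2⌉₊ ⌈((k : ℚ) - 1) / 2⌉₊

end PermPattern

namespace PermPattern

/-! Refine the count by requiring the `m` largest values to increase (`topGen`). Appending a last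
letter `v` preserves avoidance exactly when the `n - v` largest values increase; it adds `n - v`
inversions, and a left-right maximum only if `v` is the top value. This gives the difference
recurrence `topGen_sub`. At `q = -1` the recurrence has an explicit solution. For odd length the
values at `2p` and `2p + 1` coincide and equal a binomial sum `altSum` (`topGen_odd`); even lengths
acquire a factor `t - 1` or `t`, and `t - 1` at `m = 0` is the second identity. At `p = 0` the sum
is `X U(X²) - X² W(X²)`, with `U = ∑ C(N,k)² X^k` and `W = ∑ C(N,k) C(N,k+1) X^k`. Its coefficients
are the signed `s`, and coupled recurrences for `U` and `W` give the third identity. -/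

lemma not_contains_p321_iff {n : ℕ} (σ : Equiv.Perm (Fin n)) :
    ¬ Contains σ p321 ↔ ∀ i j k, i < j → j < k → σ j < σ i → ¬ σ k < σ j := by
  constructor
  · intro h i j k hij hjk hji hkj
    refine h ⟨![i, j, k], ?_, ?_⟩
    · intro a b hab
      fin_cases a <;> fin_cases b <;> simp_all
      exact hij.trans hjk
    · intro a b
      have hki := hkj.trans hji
      fin_cases a <;> fin_cases b <;>
        simp [p321, hji, hkj, hki, hji.le, hkj.le, hki.le]
  · rintro h ⟨f, hf, hσ⟩
    refine h (f 0) (f 1) (f 2) (hf _ _ (by decide)) (hf _ _ (by decide)) ?_ ?_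
    · exact (hσ 1 0).2 (by decide)
    · exact (hσ 2 1).2 (by decide)

/-! ### Appending a last letter. -/

/-- The `m` largest values of `σ` appear in increasing order. -/
def TopIncreasing {n : ℕ} (m : ℕ) (σ : Equiv.Perm (Fin n)) : Prop :=
  ∀ i j, i < j → n ≤ (σ j : ℕ) + m → σ i < σ j

/-- Append the value `v` to the word of `σ`, after raising by one all values that are at
least `v`. -/
def appendValue {n : ℕ} (v : Fin (n + 1)) (σ : Equiv.Perm (Fin n)) : Equiv.Perm (Fin (n + 1)) :=
  finSuccEquivLast.trans ((Equiv.optionCongr σ).trans (finSuccEquiv' v).symm)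

@[simp] lemma appendValue_castSucc {n : ℕ} (v : Fin (n + 1)) (σ : Equiv.Perm (Fin n)) (i : Fin n) :
    appendValue v σ i.castSucc = v.succAbove (σ i) := by
  simp [appendValue]

@[simp] lemma appendValue_last {n : ℕ} (v : Fin (n + 1)) (σ : Equiv.Perm (Fin n)) :
    appendValue v σ (Fin.last n) = v := by
  simp [appendValue]

lemma appendValue_bijective (n : ℕ) :
    Function.Bijective fun p : Fin (n + 1) × Equiv.Perm (Fin n) => appendValue p.1 p.2 := by
  rw [Fintype.bijective_iff_injective_and_card]
  constructor
  · rintro ⟨v, σ⟩ ⟨w, τ⟩ h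
    have hv : v = w := by simpa using congrArg (fun ρ => ρ (Fin.last n)) h
    subst hv
    have hσ : σ = τ := by
      ext1 i
      simpa using congrArg (fun ρ => ρ i.castSucc) h
    rw [hσ]
  · simp [Fintype.card_perm, Nat.factorial_succ]

lemma sum_perm_succ {M : Type*} [AddCommMonoid M] (n : ℕ) (F : Equiv.Perm (Fin (n + 1)) → M) :
    ∑ σ, F σ = ∑ v, ∑ σ, F (appendValue v σ) := by
  rw [← Fintype.sum_prod_type' fun v σ => F (appendValue v σ)]
  exact ((appendValue_bijective n).sum_comp F).symm

lemma inv_eq_sum {n : ℕ} (σ : Equiv.Perm (Fin n)) :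
    inv σ = ∑ j, ∑ i, if i < j ∧ σ j < σ i then 1 else 0 := by
  rw [inv, Finset.card_filter, Fintype.sum_prod_type_right]

lemma inv_appendValue {n : ℕ} (v : Fin (n + 1)) (σ : Equiv.Perm (Fin n)) :
    inv (appendValue v σ) = inv σ + (n - v) := by
  have h : ∑ x : Fin n, (if v ≤ (σ x).castSucc then 1 else 0) = n - (v : ℕ) := by
    rw [Equiv.sum_comp σ fun x => if v ≤ x.castSucc then 1 else 0]
    simp only [Fin.le_def, Fin.val_castSucc]
    rw [Fin.sum_univ_eq_sum_range (fun x => if (v : ℕ) ≤ x then 1 else 0) n, ← Finset.card_filter]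
    have : (Finset.range n).filter (fun x => (v : ℕ) ≤ x) = Finset.Ico (v : ℕ) n := by
      ext; simp; tauto
    rw [this, Nat.card_Ico]
  rw [inv_eq_sum, inv_eq_sum, Fin.sum_univ_castSucc]
  simp only [Fin.sum_univ_castSucc, appendValue_castSucc, appendValue_last,
    Fin.castSucc_lt_castSucc_iff, Fin.castSucc_lt_last, Fin.succAbove_lt_succAbove_iff,
    Fin.lt_succAbove_iff_le_castSucc, true_and, h, lt_irrefl, false_and, if_false, add_zero]
  simp [(Fin.castSucc_lt_last _).not_gt]

lemma forall_succAbove_lt_iff {n : ℕ} (v : Fin (n + 1)) (σ : Equiv.Perm (Fin n)) :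
    (∀ i, v.succAbove (σ i) < v) ↔ v = Fin.last n := by
  simp only [Fin.succAbove_lt_iff_castSucc_lt]
  constructor
  · intro h
    by_contra hv
    have hv' : (v : ℕ) < n := Fin.val_lt_last hv
    simpa [Fin.lt_def] using h (σ.symm ⟨v, hv'⟩)
  · rintro rfl i
    exact Fin.castSucc_lt_last _

lemma lrm_appendValue {n : ℕ} (v : Fin (n + 1)) (σ : Equiv.Perm (Fin n)) :
    lrm (appendValue v σ) = lrm σ + if v = Fin.last n then 1 else 0 := by
  rw [lrm, lrm, Finset.card_filter, Finset.card_filter, Fin.sum_univ_castSucc]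
  congr 1
  · refine Finset.sum_congr rfl fun i _ => ?_
    simp [Fin.forall_fin_succ', (Fin.castSucc_lt_last _).not_gt]
  · simp [Fin.forall_fin_succ', forall_succAbove_lt_iff]

/-- A new `321` must end in the appended letter, so it comes from a descent among the values raised
above `v`, the `n - v` largest. -/
lemma not_contains_appendValue {n : ℕ} (v : Fin (n + 1)) (σ : Equiv.Perm (Fin n)) :
    ¬ Contains (appendValue v σ) p321 ↔ ¬ Contains σ p321 ∧ TopIncreasing (n - v) σ := by
  have hv := v.is_le
  have key : ∀ j, n ≤ (σ j : ℕ) + (n - v) ↔ v ≤ (σ j).castSucc := by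
    intro j
    simp only [Fin.le_def, Fin.val_castSucc]
    omega
  simp only [not_contains_p321_iff, TopIncreasing, Fin.forall_fin_succ', appendValue_castSucc,
    appendValue_last, Fin.castSucc_lt_castSucc_iff, Fin.castSucc_lt_last,
    (Fin.castSucc_lt_last _).not_gt, Fin.succAbove_lt_succAbove_iff,
    Fin.lt_succAbove_iff_le_castSucc, key, lt_irrefl]
  constructor
  · intro h
    refine ⟨fun i j k hij hjk hji => ((h.1 i).1 j).1 k hij hjk hji, fun i j hij hv => ?_⟩
    by_contra hlt
    have hne : σ i ≠ σ j := fun he => hij.ne (σ.injective he)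
    exact ((h.1 i).1 j).2 hij trivial (lt_of_le_of_ne (not_lt.1 hlt) hne.symm) hv
  · rintro ⟨h1, h2⟩
    refine ⟨fun i => ⟨fun j => ⟨fun k => h1 i j k, fun hij _ hji hv => ?_⟩, by simp⟩, by simp⟩
    exact (h2 i j hij hv).not_gt hji

lemma topIncreasing_appendValue_last {n : ℕ} (m : ℕ) (σ : Equiv.Perm (Fin n)) :
    TopIncreasing (m + 1) (appendValue (Fin.last n) σ) ↔ TopIncreasing m σ := by
  simp only [TopIncreasing, Fin.forall_fin_succ', appendValue_castSucc, appendValue_last]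
  simp [(Fin.castSucc_lt_last _).not_gt, ← add_assoc]

/-- Exactly `n - v` values exceed the final `v`. If `v` were among the `m + 1` largest it would have
to exceed every other value, contradicting `hv`; otherwise the condition is inherited from `σ`. -/
lemma topIncreasing_appendValue_of_ne {n : ℕ} (m : ℕ) {v : Fin (n + 1)} (hv : v ≠ Fin.last n)
    (σ : Equiv.Perm (Fin n)) (h : TopIncreasing (n - v) σ) :
    TopIncreasing (m + 1) (appendValue v σ) ↔ m + 1 ≤ n - v := by
  have hv' : (v : ℕ) < n := Fin.val_lt_last hv
  constructor
  · intro H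
    by_contra hm
    refine hv ((forall_succAbove_lt_iff v σ).1 fun i => ?_)
    have := H i.castSucc (Fin.last n) (Fin.castSucc_lt_last i) (by simp; omega)
    simpa using this
  · intro hm
    simp only [TopIncreasing, Fin.forall_fin_succ', appendValue_castSucc, appendValue_last,
      Fin.castSucc_lt_castSucc_iff, Fin.succAbove_lt_succAbove_iff]
    refine ⟨fun i => ⟨fun j hij hj => h i j hij ?_, fun _ hh => by omega⟩, ?_⟩
    · by_contra hlt
      have : (σ j).castSucc < v := by
        simp only [Fin.lt_def, Fin.val_castSucc]
        omega
      rw [Fin.succAbove_of_castSucc_lt _ _ this] at hj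
      simp only [Fin.lt_def, Fin.val_castSucc] at this hj
      omega
    · simp [(Fin.castSucc_lt_last _).not_gt]

lemma topIncreasing_zero {n : ℕ} (σ : Equiv.Perm (Fin n)) : TopIncreasing 0 σ := by
  intro i j _ h
  have := (σ j).is_lt
  omega

lemma topIncreasing_one {n : ℕ} (σ : Equiv.Perm (Fin n)) : TopIncreasing 1 σ := by
  intro i j hij h
  have h1 := (σ i).is_lt
  have h2 : (σ i : ℕ) ≠ σ j := fun he => hij.ne (σ.injective (Fin.ext he))
  rw [Fin.lt_def]
  omega

/-! ### The refined generating function and its recurrence. -/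

open Classical in
/-- The generating function by `inv` and `lrm` of the `321`-avoiding permutations whose `m`
largest values appear in increasing order; it is `0` when `n < m`. -/
noncomputable def topGen {R : Type*} [CommRing R] (q t : R) (n m : ℕ) : R :=
  if m ≤ n then ∑ σ : Equiv.Perm (Fin n),
    if ¬ Contains σ p321 ∧ TopIncreasing m σ then q ^ inv σ * t ^ lrm σ else 0
  else 0

section topGen
variable {R : Type*} [CommRing R] (q t : R)

lemma topGen_zero_right (n : ℕ) :
    topGen q t n 0 = ∑ σ ∈ Av n p321, q ^ inv σ * t ^ lrm σ := by
  simp [topGen, topIncreasing_zero, Av, Finset.sum_filter]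

lemma topGen_succ_zero (n : ℕ) : topGen q t (n + 1) 0 = topGen q t (n + 1) 1 := by
  simp [topGen, topIncreasing_zero, topIncreasing_one]

lemma topGen_of_lt {n m : ℕ} (h : n < m) : topGen q t n m = 0 := by
  simp [topGen, h]

lemma topGen_succ_succ {n m : ℕ} (hm : m ≤ n) :
    topGen q t (n + 1) (m + 1) = t * topGen q t n m +
      ∑ j ∈ Finset.range n, if m ≤ j then q ^ (j + 1) * topGen q t n (j + 1) else 0 := by
  classical
  rw [topGen, if_pos (by omega), sum_perm_succ, Fin.sum_univ_castSucc, add_comm]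
  congr 1
  · rw [topGen, if_pos hm, Finset.mul_sum]
    refine Finset.sum_congr rfl fun σ _ => ?_
    have hT : TopIncreasing (n - (Fin.last n : ℕ)) σ := by
      simpa using topIncreasing_zero σ
    simp only [not_contains_appendValue, hT, topIncreasing_appendValue_last, inv_appendValue,
      lrm_appendValue, and_true]
    simp only [Fin.val_last, tsub_self, add_zero, if_true, mul_ite, mul_zero]
    exact if_congr Iff.rfl (by ring) rfl
  -- The index `j` corresponds to the letter `v = n - 1 - j`, which creates `j + 1` inversions.
  · rw [← Finset.sum_range_reflect, ← Fin.sum_univ_eq_sum_range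
      (fun j => if m ≤ n - 1 - j then q ^ (n - 1 - j + 1) * topGen q t n (n - 1 - j + 1) else 0)]
    refine Finset.sum_congr rfl fun v _ => ?_
    have hv : v.castSucc ≠ Fin.last n := (Fin.castSucc_lt_last v).ne
    have hn : n - 1 - (v : ℕ) + 1 = n - v := by omega
    have hm' : m ≤ n - 1 - (v : ℕ) ↔ m + 1 ≤ n - v := by omega
    rw [hn, topGen, if_pos (Nat.sub_le _ _), Finset.mul_sum]
    split_ifs with h
    · refine Finset.sum_congr rfl fun σ _ => ?_
      by_cases hσ : ¬ Contains σ p321 ∧ TopIncreasing (n - v) σ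
      · have hT := (topIncreasing_appendValue_of_ne m hv σ hσ.2).2 (hm'.1 h)
        rw [if_pos ⟨(not_contains_appendValue _ σ).2 hσ, hT⟩, if_pos hσ, inv_appendValue,
          lrm_appendValue, if_neg hv, Fin.val_castSucc]
        ring
      · rw [if_neg fun H => hσ ((not_contains_appendValue _ σ).1 H.1), if_neg hσ, mul_zero]
    · refine Finset.sum_eq_zero fun σ _ => if_neg fun H => h ?_
      have hσ := (not_contains_appendValue _ σ).1 H.1
      exact hm'.2 ((topIncreasing_appendValue_of_ne m hv σ hσ.2).1 H.2)

lemma topGen_sub {n m : ℕ} :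
    topGen q t (n + 1) (m + 1) - topGen q t (n + 1) (m + 2) =
      t * (topGen q t n m - topGen q t n (m + 1)) + q ^ (m + 1) * topGen q t n (m + 1) := by
  rcases lt_trichotomy m n with h | rfl | h
  · rw [topGen_succ_succ q t h.le, topGen_succ_succ q t (show m + 1 ≤ n from h)]
    have : ∑ j ∈ Finset.range n, (if m ≤ j then q ^ (j + 1) * topGen q t n (j + 1) else 0) -
        ∑ j ∈ Finset.range n, (if m + 1 ≤ j then q ^ (j + 1) * topGen q t n (j + 1) else 0) =
        q ^ (m + 1) * topGen q t n (m + 1) := by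
      rw [← Finset.sum_sub_distrib, Finset.sum_eq_single m]
      · simp
      · intro j _ hj
        rcases lt_or_gt_of_ne hj with hj | hj
        · rw [if_neg (by omega), if_neg (by omega), sub_zero]
        · rw [if_pos (by omega), if_pos (by omega), sub_self]
      · simp [h]
    linear_combination this
  -- The boundary case `m = n` relies on `topGen` being `0` beyond the length.
  · rw [topGen_succ_succ q t le_rfl, topGen_of_lt q t (show m < m + 1 by omega),
      topGen_of_lt q t (show m + 1 < m + 2 by omega), Finset.sum_eq_zero]
    · ring
    · intro j hj
      rw [if_neg (by simpa using hj)]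
  · simp [topGen_of_lt q t h, topGen_of_lt q t (show n + 1 < m + 1 by omega),
      topGen_of_lt q t (show n + 1 < m + 2 by omega), topGen_of_lt q t (show n < m + 1 by omega)]

end topGen

/-! ### Binomial sums and their Pascal recurrences. -/

open Polynomial

/-- The sum of `C(N,i) f(i) y ^ (N - i)` over `i`. -/
def binomSum {R : Type*} [CommRing R] (y : R) (N : ℕ) (f : ℕ → R) : R :=
  ∑ i ∈ Finset.range (N + 1), (N.choose i : R) * f i * y ^ (N - i)

section binomSum
variable {R : Type*} [CommRing R] (y t : R)

lemma binomSum_add (N : ℕ) (f g : ℕ → R) :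
    binomSum y N (fun i => f i + g i) = binomSum y N f + binomSum y N g := by
  simp only [binomSum, ← Finset.sum_add_distrib]
  exact Finset.sum_congr rfl fun i _ => by ring

lemma binomSum_succ (N : ℕ) (f : ℕ → R) :
    binomSum y (N + 1) f = y * binomSum y N f + binomSum y N fun i => f (i + 1) := by
  have h : y * binomSum y N f =
      ∑ i ∈ Finset.range (N + 1 + 1), (N.choose i : R) * f i * y ^ (N + 1 - i) := by
    rw [Finset.sum_range_succ, Nat.choose_succ_self, binomSum, Finset.mul_sum]
    simp only [Nat.cast_zero, zero_mul, add_zero]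
    refine Finset.sum_congr rfl fun i hi => ?_
    rw [Nat.sub_add_comm (by simpa [Nat.lt_succ_iff] using hi), pow_succ]
    ring
  rw [h, Finset.sum_range_succ', binomSum, Finset.sum_range_succ', binomSum, add_right_comm,
    ← Finset.sum_add_distrib]
  congr 1
  · refine Finset.sum_congr rfl fun i _ => ?_
    rw [Nat.choose_succ_succ, Nat.succ_sub_succ]
    push_cast
    ring
  · simp

/-- The polynomials `∑ i, C(N,i) (C(M,i) t - C(M,i+1)) t ^ (2 (N - i))`. -/
def altSum (N M : ℕ) : R :=
  t * binomSum (t ^ 2) N (fun i => (M.choose i : R)) -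
    binomSum (t ^ 2) N (fun i => (M.choose (i + 1) : R))

lemma binomSum_choose_succ (N M : ℕ) :
    binomSum y N (fun i => ((M + 1).choose (i + 1) : R)) =
      binomSum y N (fun i => (M.choose i : R)) + binomSum y N fun i => (M.choose (i + 1) : R) := by
  rw [← binomSum_add]
  simp [Nat.choose_succ_succ]

lemma altSum_sub (N M : ℕ) :
    altSum t (N + 1) (M + 1) - altSum t (N + 1) M =
      t ^ 2 * (altSum t N (M + 1) - altSum t N M) + altSum t N M := by
  have h : binomSum (t ^ 2) N (fun i => ((M + 1).choose (i + 1 + 1) : R)) =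
      binomSum (t ^ 2) N (fun i => (M.choose (i + 1) : R)) +
        binomSum (t ^ 2) N fun i => (M.choose (i + 1 + 1) : R) := by
    rw [← binomSum_add]
    simp [Nat.choose_succ_succ]
  simp only [altSum, binomSum_succ, h]
  simp only [binomSum_choose_succ]
  ring

lemma altSum_zero_right (N : ℕ) : altSum t N 0 = t ^ (2 * N + 1) := by
  have h : binomSum (t ^ 2) N (fun i => ((Nat.choose 0 i : ℕ) : R)) = (t ^ 2) ^ N := by
    rw [binomSum, Finset.sum_range_succ']
    simp
  have h' : binomSum (t ^ 2) N (fun i => ((Nat.choose 0 (i + 1) : ℕ) : R)) = 0 := by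
    simp [binomSum]
  rw [altSum, h, h']
  ring

/-- By Pascal the difference in `h` involves `C(N,i) C(N,i-1)`; shifting `i` absorbs the factor `t ^
2`, and the two binomials exchange roles because both have upper index `N`. -/
lemma altSum_diag_sub (N : ℕ) :
    altSum t (N + 1) (N + 1) - altSum t (N + 1) N = (1 - t) * altSum t N N := by
  have h : t ^ 2 * (binomSum (t ^ 2) N (fun i => ((N + 1).choose i : R)) -
      binomSum (t ^ 2) N (fun i => (N.choose i : R))) =
      binomSum (t ^ 2) N (fun i => (N.choose (i + 1) : R)) := by
    rw [binomSum, binomSum, Finset.sum_range_succ', Finset.sum_range_succ' _ N, binomSum,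
      Finset.sum_range_succ, Nat.choose_succ_self]
    simp only [Nat.choose_zero_right, add_sub_add_right_eq_sub, ← Finset.sum_sub_distrib,
      Finset.mul_sum, Nat.cast_zero, mul_zero, zero_mul, add_zero]
    refine Finset.sum_congr rfl fun i hi => ?_
    have hi : N - i = N - (i + 1) + 1 := by
      have := Finset.mem_range.1 hi
      omega
    rw [hi, Nat.choose_succ_succ, pow_succ]
    push_cast
    ring
  have h2 := altSum_sub t N N
  rw [h2]
  simp only [altSum, binomSum_choose_succ] at *
  linear_combination t * h

end binomSum

/-! ### The polynomials `U` and `W` and their coupled recurrences. -/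

/-- `∑ k, C(n,k) ^ 2 X ^ k` -/
noncomputable def squarePoly (n : ℕ) : ℤ[X] :=
  ∑ k ∈ Finset.range (n + 1), C ((n.choose k : ℤ) ^ 2) * X ^ k

/-- `∑ k, C(n,k) C(n,k+1) X ^ k` -/
noncomputable def adjPoly (n : ℕ) : ℤ[X] :=
  ∑ k ∈ Finset.range (n + 1), C ((n.choose k : ℤ) * n.choose (k + 1)) * X ^ k

lemma coeff_squarePoly (n k : ℕ) : (squarePoly n).coeff k = (n.choose k : ℤ) ^ 2 := by
  simp only [squarePoly, finsetSum_coeff, coeff_C_mul_X_pow, Finset.sum_ite_eq, Finset.mem_range]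
  split_ifs with h
  · rfl
  · simp [Nat.choose_eq_zero_of_lt (show n < k by omega)]

lemma coeff_adjPoly (n k : ℕ) :
    (adjPoly n).coeff k = (n.choose k : ℤ) * n.choose (k + 1) := by
  simp only [adjPoly, finsetSum_coeff, coeff_C_mul_X_pow, Finset.sum_ite_eq, Finset.mem_range]
  split_ifs with h
  · rfl
  · simp [Nat.choose_eq_zero_of_lt (show n < k by omega)]

lemma binomSum_choose (y : ℤ[X]) (n : ℕ) :
    binomSum y n (fun i => (n.choose i : ℤ[X])) = (squarePoly n).eval₂ C y := by
  rw [squarePoly, eval₂_finsetSum, ← Finset.sum_range_reflect, binomSum]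
  refine Finset.sum_congr rfl fun i hi => ?_
  have hi : i ≤ n := by simpa [Nat.lt_succ_iff] using hi
  simp [Nat.choose_symm hi, sq]

lemma binomSum_choose_succ_right (y : ℤ[X]) (n : ℕ) :
    binomSum y n (fun i => (n.choose (i + 1) : ℤ[X])) = y * (adjPoly n).eval₂ C y := by
  rw [adjPoly, eval₂_finsetSum, Finset.sum_range_succ, binomSum, Finset.sum_range_succ,
    ← Finset.sum_range_reflect]
  simp only [Nat.choose_succ_self, Nat.cast_zero, mul_zero, zero_mul, add_zero, C_0, eval₂_zero,
    Finset.mul_sum]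
  refine Finset.sum_congr rfl fun i hi => ?_
  have hi : i < n := by simpa using hi
  have h1 : n - 1 - i + 1 = n - i := by omega
  have h2 : n - (n - 1 - i) = i + 1 := by omega
  rw [← Nat.choose_symm (show n - 1 - i ≤ n by omega), h1, h2, ← Nat.choose_symm hi.le]
  simp [pow_succ]
  ring

lemma altSum_diag (n : ℕ) :
    altSum (X : ℤ[X]) n n =
      X * expand ℤ 2 (squarePoly n) - X ^ 2 * expand ℤ 2 (adjPoly n) := by
  rw [altSum, binomSum_choose, binomSum_choose_succ_right]
  -- `expand ℤ 2` is by definition `eval₂ C (X ^ 2)`.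
  rfl

lemma choose_mul_succ_eq_int (m k : ℕ) :
    ((k : ℤ) + 1) * m.choose (k + 1) = (m - k) * m.choose k := by
  rcases le_or_gt k m with h | h
  · have := Nat.choose_succ_right_eq m k
    zify [h] at this
    linarith
  · simp [Nat.choose_eq_zero_of_lt h, Nat.choose_eq_zero_of_lt (show m < k + 1 by omega)]

lemma squarePoly_rec (m : ℕ) :
    ((m : ℤ[X]) + 3) * squarePoly (m + 2) =
      2 * (1 + X) * ((m : ℤ[X]) + 2) * squarePoly (m + 1) + 2 * X * adjPoly (m + 1) -
        (1 - X) ^ 2 * ((m : ℤ[X]) + 1) * squarePoly m := by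
  -- Powers of `X` are spelled as repeated right factors so that coefficients shift mechanically.
  -- Pascal then reduces everything to neighbouring `C(m,·)`, related by `choose_mul_succ_eq_int`.
  have e : ((C ((m : ℤ) + 3) : ℤ[X])) * squarePoly (m + 2) =
      C (2 * ((m : ℤ) + 2)) * (squarePoly (m + 1) + squarePoly (m + 1) * X) +
        C 2 * (adjPoly (m + 1) * X) -
        C ((m : ℤ) + 1) * (squarePoly m - C 2 * (squarePoly m * X) + squarePoly m * X * X) := by
    ext k
    rcases k with _ | _ | k <;>
      simp only [coeff_sub, coeff_add, coeff_C_mul, coeff_mul_X, coeff_mul_X_zero,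
        coeff_squarePoly, coeff_adjPoly]
    · simp
      ring
    · simp
      ring
    · have h1 := choose_mul_succ_eq_int m k
      have h2 := choose_mul_succ_eq_int m (k + 1)
      simp only [Nat.choose_succ_succ, Nat.succ_eq_add_one]
      push_cast at *
      generalize (m.choose k : ℤ) = c at *
      generalize (m.choose (k + 1) : ℤ) = b at *
      generalize (m.choose (k + 1 + 1) : ℤ) = a at *
      linear_combination 2 * ((c + b) * h2 - (a + b) * h1)
  simp only [map_add, map_mul, map_natCast, map_ofNat, map_one] at e
  linear_combination e

lemma adjPoly_rec (m : ℕ) :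
    ((m : ℤ[X]) + 3) * adjPoly (m + 2) =
      2 * (1 + X) * ((m : ℤ[X]) + 2) * adjPoly (m + 1) + 2 * squarePoly (m + 1) -
        (1 - X) ^ 2 * ((m : ℤ[X]) + 1) * adjPoly m := by
  have e : ((C ((m : ℤ) + 3) : ℤ[X])) * adjPoly (m + 2) =
      C (2 * ((m : ℤ) + 2)) * (adjPoly (m + 1) + adjPoly (m + 1) * X) +
        C 2 * squarePoly (m + 1) -
        C ((m : ℤ) + 1) * (adjPoly m - C 2 * (adjPoly m * X) + adjPoly m * X * X) := by
    ext k
    rcases k with _ | _ | k <;>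
      simp only [coeff_sub, coeff_add, coeff_C_mul, coeff_mul_X, coeff_mul_X_zero,
        coeff_squarePoly, coeff_adjPoly]
    · simp
      ring
    · have h2 := choose_mul_succ_eq_int m 1
      rw [Nat.choose_one_right] at h2
      simp [Nat.choose_succ_succ]
      linear_combination h2
    · have h1 := choose_mul_succ_eq_int m k
      have h2 := choose_mul_succ_eq_int m (k + 1)
      have h3 := choose_mul_succ_eq_int m (k + 1 + 1)
      simp only [Nat.choose_succ_succ, Nat.succ_eq_add_one]
      push_cast at *
      generalize (m.choose k : ℤ) = d at *
      generalize (m.choose (k + 1) : ℤ) = c at *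
      generalize (m.choose (k + 1 + 1) : ℤ) = b at *
      generalize (m.choose (k + 1 + 1 + 1) : ℤ) = a at *
      linear_combination (d + c) * h3 - (a + b) * h1
  simp only [map_add, map_mul, map_natCast, map_ofNat, map_one] at e
  linear_combination e

/-! ### Solving the recurrence at `q = -1`. -/

section oddGen
variable {R : Type*} [CommRing R] (t : R)

/-- The common value of `topGen (-1) t (2 * N + 1)` at `2 * p` and `2 * p + 1`. -/
def oddGen (N p : ℕ) : R := if p ≤ N then altSum t N (N - p) else 0

lemma oddGen_of_lt {N p : ℕ} (h : N < p) : oddGen t N p = 0 := if_neg h.not_ge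

/-- This is the effect of two steps of `topGen_sub` at `q = -1`, passing from length `2N + 1` to `2N
+ 3`. -/
lemma oddGen_sub (N p : ℕ) :
    oddGen t (N + 1) (p + 1) - oddGen t (N + 1) (p + 2) =
      t ^ 2 * (oddGen t N p - oddGen t N (p + 1)) + oddGen t N (p + 1) := by
  rcases lt_trichotomy p N with h | rfl | h
  · obtain ⟨K, rfl⟩ : ∃ K, N = K + 1 + p := ⟨N - p - 1, by omega⟩
    have e1 : K + 1 + p + 1 - (p + 1) = K + 1 := by omega
    have e2 : K + 1 + p + 1 - (p + 2) = K := by omega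
    have e3 : K + 1 + p - p = K + 1 := by omega
    have e4 : K + 1 + p - (p + 1) = K := by omega
    rw [oddGen, oddGen, oddGen, oddGen, if_pos (by omega), if_pos (by omega), if_pos (by omega),
      if_pos (by omega), e1, e2, e3, e4]
    exact altSum_sub t _ K
  · rw [oddGen_of_lt t (show p + 1 < p + 2 by omega), oddGen_of_lt t (show p < p + 1 by omega),
      oddGen, oddGen, if_pos le_rfl, if_pos le_rfl, Nat.sub_self, Nat.sub_self, altSum_zero_right,
      altSum_zero_right]
    ring
  · simp [oddGen_of_lt t h, oddGen_of_lt t (show N + 1 < p + 1 by omega),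
      oddGen_of_lt t (show N + 1 < p + 2 by omega), oddGen_of_lt t (show N < p + 1 by omega)]

lemma oddGen_zero_sub (N : ℕ) :
    oddGen t (N + 1) 0 - oddGen t (N + 1) 1 = (1 - t) * oddGen t N 0 := by
  simpa [oddGen] using altSum_diag_sub t N

end oddGen

/-- Descending induction from the range where both sequences vanish; it makes `topGen_sub` determine
`topGen`. -/
lemma eq_of_sub_succ_eq {R : Type*} [AddCommGroup R] {f g : ℕ → R} {K : ℕ}
    (hf : ∀ m, K < m → f m = 0) (hg : ∀ m, K < m → g m = 0)
    (h : ∀ m, f m - f (m + 1) = g m - g (m + 1)) (m : ℕ) : f m = g m := by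
  have key : ∀ d m, K + 1 ≤ m + d → f m = g m := by
    intro d
    induction d with
    | zero => intro m hm; rw [hf m (by omega), hg m (by omega)]
    | succ d ih =>
      intro m hm
      have h1 := h m
      rw [ih (m + 1) (by omega)] at h1
      exact sub_left_injective h1
  exact key (K + 1) m (by omega)

section evaluation
variable {R : Type*} [CommRing R] (t : R)

/-- The value of `topGen (-1) t (2 * N + 2)` at `m + 1`. -/
def evenGen (N m : ℕ) : R := if Even m then (t - 1) * oddGen t N (m / 2) else t * oddGen t N (m / 2)

lemma topGen_even_of_odd {N : ℕ}
    (h : ∀ m, topGen (-1) t (2 * N + 1) m = oddGen t N (m / 2)) (m : ℕ) :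
    topGen (-1) t (2 * N + 2) (m + 1) = evenGen t N m := by
  refine eq_of_sub_succ_eq (f := fun m => topGen (-1) t (2 * N + 2) (m + 1)) (K := 2 * N + 2)
    (fun m hm => topGen_of_lt _ _ (by omega)) (fun m hm => ?_) (fun m => ?_) m
  · simp [evenGen, oddGen_of_lt t (show N < m / 2 by omega)]
  · simp only [topGen_sub (-1) t, h, evenGen]
    rcases Nat.even_or_odd' m with ⟨p, rfl | rfl⟩
    · have e : (2 * p + 1) / 2 = p := by omega
      simp [e, pow_succ]
      ring
    · have e : (2 * p + 1) / 2 = p := by omega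
      have e' : (2 * p + 1 + 1) / 2 = p + 1 := by omega
      simp [e, e', Nat.even_add_one, pow_succ]
      ring

lemma topGen_odd_of_even {N : ℕ}
    (h : ∀ m, topGen (-1) t (2 * N + 2) (m + 1) = evenGen t N m) (m : ℕ) :
    topGen (-1) t (2 * N + 3) m = oddGen t (N + 1) (m / 2) := by
  have key : ∀ m, topGen (-1) t (2 * N + 3) (m + 1) = oddGen t (N + 1) ((m + 1) / 2) := by
    refine eq_of_sub_succ_eq (f := fun m => topGen (-1) t (2 * N + 3) (m + 1)) (K := 2 * N + 3)
      (fun m hm => topGen_of_lt _ _ (by omega)) (fun m hm => ?_) (fun m => ?_)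
    · simp [oddGen_of_lt t (show N + 1 < (m + 1) / 2 by omega)]
    · simp only [topGen_sub (-1) t]
      rcases m with _ | m
      · have := oddGen_zero_sub t N
        rw [topGen_succ_zero, h 0]
        simp [evenGen]
        linear_combination - this
      · rw [h, h]
        rcases Nat.even_or_odd' m with ⟨p, rfl | rfl⟩
        · have e : (2 * p + 1) / 2 = p := by omega
          have e₀ : (2 * p + 1 + 1) / 2 = p + 1 := by omega
          have e' : (2 * p + 1 + 1 + 1) / 2 = p + 1 := by omega
          simp [e, e₀, e', evenGen, pow_succ]
          ring
        · have e : (2 * p + 1) / 2 = p := by omega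
          have e₀ : (2 * p + 1 + 1) / 2 = p + 1 := by omega
          have e' : (2 * p + 1 + 1 + 1) / 2 = p + 1 := by omega
          have e'' : (2 * p + 1 + 1 + 1 + 1) / 2 = p + 2 := by omega
          have := oddGen_sub t N p
          simp [e, e₀, e', e'', evenGen, Nat.even_add_one, pow_succ]
          linear_combination - this
  rcases m with _ | m
  · rw [topGen_succ_zero]
    exact key 0
  · exact key m

lemma topGen_one (m : ℕ) : topGen (-1) t 1 m = oddGen t 0 (m / 2) := by
  have h : topGen (-1) t 1 1 = t := by
    rw [topGen_succ_succ _ _ le_rfl]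
    simp [topGen_zero_right, Av, not_contains_p321_iff, inv, lrm]
  have h0 : oddGen t 0 0 = t := by simp [oddGen, altSum_zero_right]
  rcases m with _ | _ | m
  · rw [topGen_succ_zero, h, Nat.zero_div, h0]
  · simp [h, h0]
  · rw [topGen_of_lt _ _ (by omega), oddGen_of_lt _ (by omega)]

lemma topGen_odd (N m : ℕ) : topGen (-1) t (2 * N + 1) m = oddGen t N (m / 2) := by
  induction N generalizing m with
  | zero => exact topGen_one t m
  | succ N ih => exact topGen_odd_of_even t (topGen_even_of_odd t ih) m

end evaluation

/-! ### Closed forms and the three-term recurrence. -/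

lemma signedPoly_eq_sum (n : ℕ) :
    signedPoly n = ∑ σ ∈ Av n p321, (-1 : ℤ[X]) ^ inv σ * X ^ lrm σ := by
  simp [signedPoly, invPoly, Polynomial.map_sum]

lemma signedPoly_eq_topGen (n : ℕ) : signedPoly n = topGen (-1) X n 0 := by
  rw [signedPoly_eq_sum, topGen_zero_right]

lemma signedPoly_odd (N : ℕ) : signedPoly (2 * N + 1) =
    X * expand ℤ 2 (squarePoly N) - X ^ 2 * expand ℤ 2 (adjPoly N) := by
  rw [signedPoly_eq_topGen, topGen_odd, ← altSum_diag]
  simp [oddGen]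

lemma signedPoly_even (N : ℕ) : signedPoly (2 * N + 2) = (X - 1) * signedPoly (2 * N + 1) := by
  rw [signedPoly_eq_topGen, signedPoly_eq_topGen, topGen_succ_zero,
    topGen_even_of_odd X (topGen_odd X N) 0, topGen_odd]
  simp [evenGen]

lemma signedPoly_rec (m : ℕ) :
    ((m : ℤ[X]) + 3) * signedPoly (2 * m + 5) =
      2 * ((1 + X ^ 2) * ((m : ℤ[X]) + 2) - X) * signedPoly (2 * m + 3) -
        (1 - X ^ 2) ^ 2 * ((m : ℤ[X]) + 1) * signedPoly (2 * m + 1) := by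
  have hU := congrArg (expand ℤ 2) (squarePoly_rec m)
  have hW := congrArg (expand ℤ 2) (adjPoly_rec m)
  simp only [map_add, map_sub, map_mul, map_pow, map_natCast, map_ofNat, map_one, expand_X]
    at hU hW
  rw [show 2 * m + 5 = 2 * (m + 2) + 1 by ring, show 2 * m + 3 = 2 * (m + 1) + 1 by ring,
    signedPoly_odd, signedPoly_odd, signedPoly_odd]
  -- The cross terms `2 X² W` and `2 U` recombine into `-2 X (X U - X² W)`, the source of the `-X`
  -- in the middle factor.
  linear_combination X * hU - X ^ 2 * hW

/-! ### Comparison of coefficients with `s`. -/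

lemma floor_half (j : ℕ) : ⌊(((2 * j + 1 : ℕ) : ℚ) - 1) / 2⌋₊ = j := by
  have : (((2 * j + 1 : ℕ) : ℚ) - 1) / 2 = (j : ℚ) := by push_cast; ring
  rw [this, Nat.floor_natCast]

lemma ceil_half (j : ℕ) : ⌈(((2 * j + 1 : ℕ) : ℚ) - 1) / 2⌉₊ = j := by
  have : (((2 * j + 1 : ℕ) : ℚ) - 1) / 2 = (j : ℚ) := by push_cast; ring
  rw [this, Nat.ceil_natCast]

lemma floor_half' (j : ℕ) : ⌊(((2 * j + 2 : ℕ) : ℚ) - 1) / 2⌋₊ = j := by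
  have h : (0 : ℚ) ≤ (((2 * j + 2 : ℕ) : ℚ) - 1) / 2 := by
    push_cast
    linarith [(Nat.cast_nonneg j : (0 : ℚ) ≤ j)]
  rw [Nat.floor_eq_iff h]
  push_cast
  constructor <;> linarith

lemma ceil_half' (j : ℕ) : ⌈(((2 * j + 2 : ℕ) : ℚ) - 1) / 2⌉₊ = j + 1 := by
  rw [Nat.ceil_eq_iff (by omega)]
  push_cast
  constructor <;> linarith

lemma s_odd_odd (N j : ℕ) : s (2 * N + 1) (2 * j + 1) = N.choose j * N.choose j := by
  simp only [s, floor_half, ceil_half]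

lemma s_odd_even (N j : ℕ) : s (2 * N + 1) (2 * j + 2) = N.choose j * N.choose (j + 1) := by
  simp only [s, floor_half, ceil_half, floor_half', ceil_half']

lemma s_even_odd (N j : ℕ) : s (2 * N + 2) (2 * j + 1) = N.choose j * (N + 1).choose j := by
  simp only [s, floor_half, ceil_half, floor_half', ceil_half']

lemma s_even_even (N j : ℕ) :
    s (2 * N + 2) (2 * j + 2) = N.choose j * (N + 1).choose (j + 1) := by
  simp only [s, floor_half', ceil_half']

lemma coeff_sum_s (n k : ℕ) :
    (∑ k ∈ Finset.Icc 1 n, (-1 : ℤ[X]) ^ (n - k) * (s n k : ℤ[X]) * X ^ k).coeff k =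
      if k ∈ Finset.Icc 1 n then (-1) ^ (n - k) * (s n k : ℤ) else 0 := by
  have h : ∀ k, (-1 : ℤ[X]) ^ (n - k) * (s n k : ℤ[X]) * X ^ k =
      C ((-1) ^ (n - k) * (s n k : ℤ)) * X ^ k := by simp
  simp only [h, finsetSum_coeff, coeff_C_mul_X_pow, Finset.sum_ite_eq]

lemma coeff_expand_two_odd (p : ℤ[X]) (j : ℕ) : (expand ℤ 2 p).coeff (2 * j + 1) = 0 := by
  rw [coeff_expand (by norm_num), if_neg (by omega)]

lemma coeff_expand_two_even (p : ℤ[X]) (j : ℕ) : (expand ℤ 2 p).coeff (2 * j) = p.coeff j :=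
  coeff_expand_mul' (by norm_num) p j

lemma coeff_signedPoly_odd_odd (N j : ℕ) :
    (signedPoly (2 * N + 1)).coeff (2 * j + 1) = (N.choose j : ℤ) ^ 2 := by
  have h : X ^ 2 * expand ℤ 2 (adjPoly N) = expand ℤ 2 (X * adjPoly N) := by simp
  rw [signedPoly_odd, h, coeff_sub, coeff_expand_two_odd, coeff_X_mul, coeff_expand_two_even,
    coeff_squarePoly, sub_zero]

lemma coeff_signedPoly_odd_even (N j : ℕ) :
    (signedPoly (2 * N + 1)).coeff (2 * j + 2) = - ((N.choose j : ℤ) * N.choose (j + 1)) := by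
  rw [signedPoly_odd, coeff_sub, coeff_X_mul, coeff_expand_two_odd, coeff_X_pow_mul,
    coeff_expand_two_even, coeff_adjPoly, zero_sub]

lemma coeff_signedPoly_odd_zero (N : ℕ) : (signedPoly (2 * N + 1)).coeff 0 = 0 := by
  rw [signedPoly_odd, sq, mul_assoc, coeff_sub, coeff_X_mul_zero, coeff_X_mul_zero, sub_zero]

lemma eq_sum_s_of_coeff {n : ℕ} {p : ℤ[X]} (h0 : p.coeff 0 = 0)
    -- The exponent `n + (k + 1)` has the parity of the difference and avoids truncated subtraction.
    (h1 : ∀ k, p.coeff (k + 1) = (-1) ^ (n + (k + 1)) * (s n (k + 1) : ℤ))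
    (h2 : ∀ k, n < k → s n k = 0) :
    p = ∑ k ∈ Finset.Icc 1 n, (-1 : ℤ[X]) ^ (n - k) * (s n k : ℤ[X]) * X ^ k := by
  ext k
  rw [coeff_sum_s]
  rcases k with _ | k
  · simp [h0]
  · rw [h1]
    split_ifs with h
    · obtain ⟨d, rfl⟩ : ∃ d, n = k + 1 + d := ⟨n - (k + 1), by simp at h; omega⟩
      rw [Nat.add_sub_cancel_left, show k + 1 + d + (k + 1) = 2 * (k + 1) + d by ring, pow_add,
        pow_mul, neg_one_sq, one_pow, one_mul]
    · rw [h2 _ (by simpa using h), Nat.cast_zero, mul_zero]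

lemma signedPoly_odd_eq (N : ℕ) : signedPoly (2 * N + 1) =
    ∑ k ∈ Finset.Icc 1 (2 * N + 1),
      (-1 : ℤ[X]) ^ (2 * N + 1 - k) * (s (2 * N + 1) k : ℤ[X]) * X ^ k := by
  refine eq_sum_s_of_coeff (coeff_signedPoly_odd_zero N) (fun k => ?_) (fun k hk => ?_)
  · rcases Nat.even_or_odd' k with ⟨j, rfl | rfl⟩
    · rw [coeff_signedPoly_odd_odd, s_odd_odd, Even.neg_one_pow ⟨N + j + 1, by ring⟩]
      push_cast
      ring
    · rw [coeff_signedPoly_odd_even, s_odd_even, Odd.neg_one_pow ⟨N + j + 1, by ring⟩]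
      push_cast
      ring
  · rcases Nat.even_or_odd' k with ⟨j, rfl | rfl⟩
    · obtain ⟨i, rfl⟩ : ∃ i, j = i + 1 := ⟨j - 1, by omega⟩
      rw [show 2 * (i + 1) = 2 * i + 2 by ring, s_odd_even,
        Nat.choose_eq_zero_of_lt (show N < i + 1 by omega), mul_zero]
    · rw [s_odd_odd, Nat.choose_eq_zero_of_lt (show N < j by omega), mul_zero]

lemma signedPoly_even_eq (N : ℕ) : signedPoly (2 * N + 2) =
    ∑ k ∈ Finset.Icc 1 (2 * N + 2),
      (-1 : ℤ[X]) ^ (2 * N + 2 - k) * (s (2 * N + 2) k : ℤ[X]) * X ^ k := by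
  rw [signedPoly_even]
  refine eq_sum_s_of_coeff ?_ (fun k => ?_) (fun k hk => ?_)
  · simp [sub_mul, coeff_signedPoly_odd_zero]
  · rw [sub_mul, coeff_sub, coeff_X_mul, one_mul]
    rcases Nat.even_or_odd' k with ⟨j, rfl | rfl⟩
    · rw [coeff_signedPoly_odd_odd, s_even_odd, Odd.neg_one_pow ⟨N + j + 1, by ring⟩]
      rcases j with _ | j
      · simp [coeff_signedPoly_odd_zero]
      · rw [show 2 * (j + 1) = 2 * j + 2 by ring, coeff_signedPoly_odd_even, Nat.choose_succ_succ N]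
        push_cast
        ring
    · rw [coeff_signedPoly_odd_odd, coeff_signedPoly_odd_even, s_even_even,
        Even.neg_one_pow ⟨N + j + 2, by ring⟩, Nat.choose_succ_succ N]
      push_cast
      ring
  · rcases Nat.even_or_odd' k with ⟨j, rfl | rfl⟩
    · obtain ⟨i, rfl⟩ : ∃ i, j = i + 1 := ⟨j - 1, by omega⟩
      rw [show 2 * (i + 1) = 2 * i + 2 by ring, s_even_even,
        Nat.choose_eq_zero_of_lt (show N < i by omega), zero_mul]
    · rw [s_even_odd, Nat.choose_eq_zero_of_lt (show N < j by omega), zero_mul]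

end PermPattern

open PermPattern Polynomial in
/-- In the last identity the index `2 * n - 3` truncates only for `n = 1`, where that term carries
the factor `n - 1 = 0`. -/
theorem mainTheorem3 (n : ℕ) (hn : 1 ≤ n) :
    (signedPoly n = ∑ σ ∈ Av n p321, (-1 : ℤ[X]) ^ inv σ * X ^ lrm σ ∧
      ∑ σ ∈ Av n p321, (-1 : ℤ[X]) ^ inv σ * X ^ lrm σ =
        ∑ k ∈ Finset.Icc 1 n, (-1 : ℤ[X]) ^ (n - k) * (s n k : ℤ[X]) * X ^ k) ∧
    signedPoly (2 * n) = (X - 1) * signedPoly (2 * n - 1) ∧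
    ((n : ℤ[X]) + 1) * signedPoly (2 * n + 1) =
      2 * ((1 + X ^ 2) * (n : ℤ[X]) - X) * signedPoly (2 * n - 1) -
        (1 - X ^ 2) ^ 2 * ((n : ℤ[X]) - 1) * signedPoly (2 * n - 3) := by
  refine ⟨⟨signedPoly_eq_sum n, ?_⟩, ?_, ?_⟩
  · rw [← signedPoly_eq_sum]
    rcases Nat.even_or_odd' n with ⟨j, rfl | rfl⟩
    · obtain ⟨N, rfl⟩ : ∃ N, j = N + 1 := ⟨j - 1, by omega⟩
      exact signedPoly_even_eq N
    · exact signedPoly_odd_eq j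
  · obtain ⟨N, rfl⟩ : ∃ N, n = N + 1 := ⟨n - 1, by omega⟩
    exact signedPoly_even N
  · obtain ⟨N, rfl⟩ : ∃ N, n = N + 1 := ⟨n - 1, by omega⟩
    -- For `n = 1` the recurrence has no predecessor, so the two polynomials are computed directly.
    rcases N with _ | m
    · have h1 := signedPoly_odd 0
      have h3 := signedPoly_odd 1
      simp [squarePoly, adjPoly, Finset.sum_range_succ] at h1 h3
      simp [h1, h3]
      ring
    · have h := signedPoly_rec m
      rw [show 2 * (m + 1 + 1) + 1 = 2 * m + 5 by ring,
        show 2 * (m + 1 + 1) - 1 = 2 * m + 3 by omega,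
        show 2 * (m + 1 + 1) - 3 = 2 * m + 1 by omega]
      push_cast
      linear_combination h
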